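/- Let $L\ge 1$ be an integer and let $0<p<1$, $0<q<1$. The walk perturbed at $L$-extrema is the nearest-neighbour random process $(X_k)_{k\ge 0}$ on $\mathbb{Z}$ which, given its past $X_0,\dots,X_k$, moves to $X_k+1$ with probability $p$ if $X_k=\max_{0\le m\le L\wedge k}X_{k-m}$, with probability $q$ if $X_k=\min_{0\le m\le L\wedge k}X_{k-m}$, and with probability $\frac12$ otherwise (also with probability $\frac12$ if $X_k$ is both the maximum and the minimum), and otherwise moves to $X_k-1$. For $k\ge L$ let $Y_k=(\eta_k^1,\dots,\eta_k^L)\in\{-1,+1\}^L$ with $\eta_k^i=X_{k-i+1}-X_{k-i}$. Call $\eta\in\{-1,+1\}^L$ a local maximum if $\eta^1+\dots+\eta^j\ge 0$ for all $1\le j\le L$, and a local minimum if $\eta^1+\dots+\eta^j\le 0$ for all $1\le j\le L$. The chain $Y_k$ has a limiting occupational measure $\pi$ on $\{-1,+1\}^L$, which depends only on $L,p,q$: for every such walk, almost surely, for every $\eta$ the fraction of the times $L\le k<L+n$ with $Y_k=\eta$ converges to $\pi(\eta)$ as $n\to\infty$. Let $\pi(\max)$ and $\pi(\min)$ be the sums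 of $\pi(\eta)$ over the local maxima and over the local minima $\eta$, respectively, and let $$\Delta_L=(2p-1)\,\pi(\max)+(2q-1)\,\pi(\min).$$ Then $\Delta_L<0$, $\Delta_L=0$ or $\Delta_L>0$ if and only if $p+q-1<0$, $p+q-1=0$ or $p+q-1>0$, respectively. -/

import Mathlib

open MeasureTheory Filter Topology

namespace PerturbedWalk

/-- `x k` is the maximum of the values of the path `x` at the times `k - m`, `0 ≤ m ≤ min L k`. -/
def AtMax (L : ℕ) (x : ℕ → ℤ) (k : ℕ) : Prop :=
  ∀ m ≤ min L k, x (k - m) ≤ x k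

/-- `x k` is the minimum of the values of the path `x` at the times `k - m`, `0 ≤ m ≤ min L k`. -/
def AtMin (L : ℕ) (x : ℕ → ℤ) (k : ℕ) : Prop :=
  ∀ m ≤ min L k, x k ≤ x (k - m)

open Classical in
/-- The probability that the walk, having followed the path `x` up to time `k`, makes a step to
the right: `p` at the maximum, `q` at the minimum, `1/2` otherwise (and `1/2` if `x k` is both the
maximum and the minimum). -/
noncomputable def stepUp (L : ℕ) (p q : ℝ) (x : ℕ → ℤ) (k : ℕ) : ℝ :=
  if AtMax L x k ∧ AtMin L x k then 1 / 2
  else if AtMax L x k then p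
  else if AtMin L x k then q
  else 1 / 2

/-- `X` is a perturbed at `L`-extrema random walk with parameters `p` and `q` (started from an
arbitrary integer-valued random variable `X 0`): given any initial piece `x 0, …, x k` of the
trajectory, the next step is `+1` with probability `stepUp L p q x k`, and `-1` otherwise. -/
structure IsPerturbedWalk {Ω : Type*} [MeasurableSpace Ω] (μ : Measure Ω) (L : ℕ) (p q : ℝ)
    (X : ℕ → Ω → ℤ) : Prop where
  measurable : ∀ k, Measurable (X k)
  step_right : ∀ (k : ℕ) (x : ℕ → ℤ),
    μ.real {ω | (∀ j ≤ k, X j ω = x j) ∧ X (k + 1) ω = x k + 1} =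
      stepUp L p q x k * μ.real {ω | ∀ j ≤ k, X j ω = x j}
  step_left : ∀ (k : ℕ) (x : ℕ → ℤ),
    μ.real {ω | (∀ j ≤ k, X j ω = x j) ∧ X (k + 1) ω = x k - 1} =
      (1 - stepUp L p q x k) * μ.real {ω | ∀ j ≤ k, X j ω = x j}

/-- The state space `{-1, +1} ^ L`; the coordinate `i : Fin L` stands for the `(i + 1)`-st most
recent step. -/
abbrev State (L : ℕ) : Type := Fin L → ℤˣ

/-- The last `L` steps before time `k` (for `k ≥ L`), the most recent first, are given by `η`. -/
def HasState {L : ℕ} (x : ℕ → ℤ) (k : ℕ) (η : State L) : Prop :=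
  ∀ i : Fin L, x (k - i) - x (k - i - 1) = (η i : ℤ)

/-- `S(η, j)`, the sum of the first `j` coordinates of `η`. -/
def partialSum {L : ℕ} (η : State L) (j : ℕ) : ℤ :=
  ∑ i : Fin L, if (i : ℕ) < j then (η i : ℤ) else 0

/-- The state `η` is a local maximum. -/
def IsLocMax {L : ℕ} (η : State L) : Prop :=
  ∀ j : ℕ, 1 ≤ j → j ≤ L → 0 ≤ partialSum η j

/-- The state `η` is a local minimum. -/
def IsLocMin {L : ℕ} (η : State L) : Prop :=
  ∀ j : ℕ, 1 ≤ j → j ≤ L → partialSum η j ≤ 0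

open Classical in
/-- The fraction of the times `k = L, …, L + n - 1` at which the path `x` has the state `η`. -/
noncomputable def occupation {L : ℕ} (x : ℕ → ℤ) (η : State L) (n : ℕ) : ℝ :=
  (((Finset.range n).filter fun k => HasState x (L + k) η).card : ℝ) / (n : ℝ)

/-- `π` is the limiting occupational measure of the chain of the last `L` steps of `X`: almost
surely, the fraction of time spent in each state `η` converges to `π η`. -/
def IsLimitingOccupation {Ω : Type*} [MeasurableSpace Ω] (μ : Measure Ω) {L : ℕ}
    (X : ℕ → Ω → ℤ) (π : State L → ℝ) : Prop :=
  ∀ᵐ ω ∂μ, ∀ η : State L, Tendsto (occupation (fun k => X k ω) η) atTop (𝓝 (π η))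

open Classical in
/-- `π(max)`, the total mass of the local maxima. -/
noncomputable def massMax {L : ℕ} (π : State L → ℝ) : ℝ :=
  ∑ η : State L, if IsLocMax η then π η else 0

open Classical in
/-- `π(min)`, the total mass of the local minima. -/
noncomputable def massMin {L : ℕ} (π : State L → ℝ) : ℝ :=
  ∑ η : State L, if IsLocMin η then π η else 0

/-- The speed `Δ = (2p - 1) π(max) + (2q - 1) π(min)`. -/
noncomputable def speed {L : ℕ} (p q : ℝ) (π : State L → ℝ) : ℝ :=
  (2 * p - 1) * massMax π + (2 * q - 1) * massMin π

end PerturbedWalk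

/-! The last `L` steps form a finite Markov chain. Every state can be reached by successive steps,
each of positive probability, so harmonic functions are constant; `exists_stationary` deduces a
positive stationary law `π` and the solvability of the Poisson equation. With a Poisson solution,
the occupation count of a state becomes its expected linear term plus a bounded term plus a
martingale, which gives the almost sure limit in `IsPerturbedWalk.isLimitingOccupation`.

For the sign, compare the `(p, q)` chain with the symmetric one `(p, 1 - p)`. Let `V n` be the mean
displacement of the symmetric walk in `n` steps. The two transition rules differ only at local
minima, so averaging against the `(p, q)`-stationary `π` gives `A (n + 1) = A n + speed - (p + q -
1) * G n`, where `A n` is the mean of `V n` and `G n` sums over local minima the gain from stepping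
right rather than left (`sum_meanDisplacement_succ`).

By reflection symmetry the `(p, 1 - p)` walk has no drift, so `V n`, hence `A n`, is bounded. By
`exists_le_gain`, `G n` is eventually bounded below by a positive constant. A bounded sequence
cannot have increments that stay away from zero with one sign, so the speed has the sign of `p + q -
1`. The gain bound comes from a coupling for `p ≤ 1/2` and from monotonicity for `p ≥ 1/2`. -/

namespace PerturbedWalk

variable {L : ℕ}

/-! ### States, their partial sums and reflection -/

/-- The state after the step `ε` from the state `η`. -/
def push (ε : ℤˣ) (η : State L) : State L := fun i =>
  if (i : ℕ) = 0 then ε else η ⟨(i : ℕ) - 1, lt_of_le_of_lt (Nat.sub_le _ _) i.2⟩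

@[simp] lemma partialSum_zero (η : State L) : partialSum η 0 = 0 := by
  simp [partialSum]

lemma partialSum_push (ε : ℤˣ) (η : State L) {j : ℕ} (hj : j < L) :
    partialSum (push ε η) (j + 1) = ε + partialSum η j := by
  obtain ⟨N, rfl⟩ : ∃ N, L = N + 1 := ⟨L - 1, by omega⟩
  unfold partialSum
  rw [Fin.sum_univ_succ, Fin.sum_univ_castSucc (n := N)]
  have h1 : ¬ N < j := by omega
  simp [push, h1]
  rfl

lemma partialSum_neg (η : State L) (j : ℕ) : partialSum (-η) j = -partialSum η j := by
  unfold partialSum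
  rw [← Finset.sum_neg_distrib]
  refine Finset.sum_congr rfl fun i _ => ?_
  split_ifs <;> simp

lemma isLocMax_neg (η : State L) : IsLocMax (-η) ↔ IsLocMin η := by
  simp [IsLocMax, IsLocMin, partialSum_neg]

lemma isLocMin_neg (η : State L) : IsLocMin (-η) ↔ IsLocMax η := by
  simp [IsLocMax, IsLocMin, partialSum_neg]

lemma push_neg (ε : ℤˣ) (η : State L) : push (-ε) (-η) = -push ε η := by
  funext i
  simp only [push, Pi.neg_apply]
  split_ifs <;> rfl

lemma not_isLocMax_and_isLocMin (hL : 1 ≤ L) (η : State L) : ¬ (IsLocMax η ∧ IsLocMin η) := by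
  rintro ⟨h1, h2⟩
  have h0 : partialSum η 1 = 0 := le_antisymm (h2 1 le_rfl hL) (h1 1 le_rfl hL)
  obtain ⟨N, rfl⟩ : ∃ N, L = N + 1 := ⟨L - 1, by omega⟩
  unfold partialSum at h0
  rw [Fin.sum_univ_succ] at h0
  simp at h0

/-- A nonempty set of states that is closed under all steps contains every state. -/
lemma mem_of_push_closed (T : Set (State L)) {η₀ : State L} (h₀ : η₀ ∈ T)
    (hT : ∀ ε, ∀ η ∈ T, push ε η ∈ T) (ζ : State L) : ζ ∈ T := by
  -- The target `ζ` is fed in from its oldest coordinate: after `j` pushes the newest `j`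
  -- coordinates are the oldest `j` of `ζ`.
  have key : ∀ j ≤ L, ∃ η ∈ T, ∀ (i k : Fin L), (i : ℕ) < j → (k : ℕ) + j = i + L →
      η i = ζ k := by
    intro j
    induction j with
    | zero => exact fun _ => ⟨η₀, h₀, fun i k hi => absurd hi (Nat.not_lt_zero _)⟩
    | succ j ih =>
      intro hj
      obtain ⟨η, hη, h⟩ := ih (by omega)
      refine ⟨push (ζ ⟨L - (j + 1), by omega⟩) η, hT _ _ hη, fun i k hi hk => ?_⟩
      unfold push
      split_ifs with h0
      · congr 1
        ext
        simp only
        omega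
      · exact h _ _ (by simp only; omega) (by simp only; omega)
  obtain ⟨η, hη, h⟩ := key L le_rfl
  have : η = ζ := funext fun i => h i i i.2 rfl
  exact this ▸ hη

/-! ### The finite chain: stationary law and Poisson equation -/

open Classical in
/-- The probability of a step to the right from the state `η`. -/
noncomputable def upProb (p q : ℝ) (η : State L) : ℝ :=
  if IsLocMax η then p else if IsLocMin η then q else 1 / 2

lemma upProb_mem {p q : ℝ} (hp0 : 0 < p) (hp1 : p < 1) (hq0 : 0 < q) (hq1 : q < 1)
    (η : State L) : 0 < upProb p q η ∧ upProb p q η < 1 := by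
  unfold upProb
  split_ifs <;> constructor <;> linarith

/-- The transition operator of the chain of the last `L` steps. -/
noncomputable def transition (p q : ℝ) : (State L → ℝ) →ₗ[ℝ] (State L → ℝ) where
  toFun f η := upProb p q η * f (push 1 η) + (1 - upProb p q η) * f (push (-1) η)
  map_add' f g := by funext η; simp only [Pi.add_apply]; ring
  map_smul' c f := by
    funext η; simp only [Pi.smul_apply, smul_eq_mul, RingHom.id_apply]; ring

lemma transition_apply (p q : ℝ) (f : State L → ℝ) (η : State L) :
    transition p q f η =
      upProb p q η * f (push 1 η) + (1 - upProb p q η) * f (push (-1) η) := rfl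

section Stationary

variable {p q : ℝ} (hp0 : 0 < p) (hp1 : p < 1) (hq0 : 0 < q) (hq1 : q < 1)
include hp0 hp1 hq0 hq1

lemma transition_le {f : State L → ℝ} {c : ℝ} (hf : ∀ η, f η ≤ c) (η : State L) :
    transition p q f η ≤ c := by
  obtain ⟨h0, h1⟩ := upProb_mem hp0 hp1 hq0 hq1 η
  rw [transition_apply]
  nlinarith [hf (push 1 η), hf (push (-1) η)]

lemma le_transition {f : State L → ℝ} {c : ℝ} (hf : ∀ η, c ≤ f η) (η : State L) :
    c ≤ transition p q f η := by
  obtain ⟨h0, h1⟩ := upProb_mem hp0 hp1 hq0 hq1 η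
  rw [transition_apply]
  nlinarith [hf (push 1 η), hf (push (-1) η)]

/-- Maximum principle: at a maximum both successors carry positive weight, so both are maxima, and
the set of maxima is closed under steps. -/
lemma harmonic_eq_const {f : State L → ℝ} (hf : transition p q f = f) (η ζ : State L) :
    f η = f ζ := by
  obtain ⟨m, hm⟩ := Finite.exists_max f
  have key : ∀ ζ, ζ ∈ {η | f η = f m} := by
    refine mem_of_push_closed _ (η₀ := m) rfl fun ε η hη => ?_
    obtain ⟨h0, h1⟩ := upProb_mem hp0 hp1 hq0 hq1 η
    have h := congrFun hf η
    rw [transition_apply, show f η = f m from hη] at h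
    have ha := hm (push 1 η)
    have hb := hm (push (-1) η)
    rcases Int.units_eq_one_or ε with rfl | rfl
    · refine le_antisymm ha ?_
      nlinarith
    · refine le_antisymm hb ?_
      nlinarith
  exact (key η).trans (key ζ).symm

/-- The chain has a strictly positive stationary distribution, and its Poisson equation is
solvable. -/
lemma exists_stationary : ∃ π : State L → ℝ, (∀ η, 0 < π η) ∧ ∑ η, π η = 1 ∧
    (∀ f : State L → ℝ, ∑ η, π η * transition p q f η = ∑ η, π η * f η) ∧
    ∀ f : State L → ℝ, ∃ h : State L → ℝ,
      ∀ η, f η - ∑ ζ, π ζ * f ζ = h η - transition p q h η := by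
  classical
  let η₀ : State L := fun _ => 1
  -- Adding the value at `η₀` to `1 - P` removes the constants from the kernel. The value at `η₀` of
  -- `Ψ⁻¹ f` is then the stationary mean of `f`, and `Ψ⁻¹ f` solves its Poisson equation.
  let Ψ : (State L → ℝ) →ₗ[ℝ] (State L → ℝ) :=
    LinearMap.id - transition p q +
      (LinearMap.pi fun _ : State L => (LinearMap.proj η₀ : (State L → ℝ) →ₗ[ℝ] ℝ))
  have hΨ : ∀ h η, Ψ h η = h η - transition p q h η + h η₀ := fun h η => rfl
  have hinj : Function.Injective Ψ := by
    rw [← LinearMap.ker_eq_bot, LinearMap.ker_eq_bot']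
    intro h hh
    have h1 : ∀ η, h η - transition p q h η + h η₀ = 0 := fun η => congrFun hh η
    obtain ⟨a, ha⟩ := Finite.exists_max h
    obtain ⟨b, hb⟩ := Finite.exists_min h
    have e0 : h η₀ = 0 := by
      have := transition_le hp0 hp1 hq0 hq1 ha a
      have := le_transition hp0 hp1 hq0 hq1 hb b
      linarith [h1 a, h1 b]
    have e1 : transition p q h = h := funext fun η => by linarith [h1 η]
    funext η
    rw [harmonic_eq_const hp0 hp1 hq0 hq1 e1 η η₀, e0]
    rfl
  let e := LinearEquiv.ofInjectiveEndo Ψ hinj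
  let c : (State L → ℝ) →ₗ[ℝ] ℝ := LinearMap.proj η₀ ∘ₗ e.symm.toLinearMap
  have hc : ∀ h, c (Ψ h) = h η₀ := fun h =>
    congrFun (LinearEquiv.ofInjectiveEndo_left_inv Ψ hinj |> fun t => DFunLike.congr_fun t h) η₀
  have hpoisson : ∀ f, ∃ h : State L → ℝ, ∀ η, f η - c f = h η - transition p q h η := by
    intro f
    obtain ⟨h, rfl⟩ := (LinearMap.injective_iff_surjective.mp hinj) f
    exact ⟨h, fun η => by rw [hc, hΨ]; ring⟩
  have hlow : ∀ f : State L → ℝ, ∀ a, (∀ η, a ≤ f η) → a ≤ c f := by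
    intro f a hf
    obtain ⟨h, hh⟩ := hpoisson f
    obtain ⟨b, hb⟩ := Finite.exists_min h
    linarith [hh b, hf b, le_transition hp0 hp1 hq0 hq1 hb b]
  have hstat : ∀ f, c (transition p q f) = c f := by
    intro f
    have := hc (-f + fun _ => f η₀)
    have e2 : Ψ (-f + fun _ => f η₀) = transition p q f - f := by
      funext η
      have e3 : transition p q (fun _ : State L => f η₀) = fun _ => f η₀ := by
        funext η; rw [transition_apply]; ring
      rw [hΨ, map_add, map_neg, e3]
      simp
      ring
    rw [e2, map_sub] at this
    simp at this
    linarith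
  have hsum : ∀ f : State L → ℝ, ∑ η, c (Pi.single η 1) * f η = c f := by
    intro f
    conv_rhs => rw [pi_eq_sum_univ' f]
    rw [map_sum]
    refine Finset.sum_congr rfl fun η _ => ?_
    rw [map_smul, smul_eq_mul, mul_comm]
  have hc1 : c (fun _ => 1) = 1 := by
    have := hc (fun _ => 1)
    convert this using 2
    funext η
    rw [hΨ, transition_apply]
    ring
  have hnonneg : ∀ η, 0 ≤ c (Pi.single η 1) := fun η => hlow _ _ fun ζ => by
    rw [Pi.single_apply]; split_ifs <;> norm_num
  have htot : ∑ η, c (Pi.single η 1) = 1 := by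
    have := hsum fun _ => 1
    simpa [hc1] using this
  refine ⟨fun η => c (Pi.single η 1), ?_, htot, fun f => ?_, fun f => ?_⟩
  · obtain ⟨η₁, -, h₁⟩ : ∃ η ∈ Finset.univ, 0 < c (Pi.single η 1) := by
      by_contra! hcon
      have := Finset.sum_nonpos hcon
      rw [htot] at this
      linarith
    refine mem_of_push_closed {η | 0 < c (Pi.single η 1)} h₁ fun ε η hη => ?_
    have h2 := hstat (Pi.single (push ε η) 1)
    rw [← hsum] at h2
    change 0 < c (Pi.single (push ε η) 1)
    rw [← h2]
    have hnn : ∀ ζ, 0 ≤ transition p q (Pi.single (push ε η) 1) ζ := fun ζ =>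
      le_transition hp0 hp1 hq0 hq1 (fun θ => by
        rw [Pi.single_apply]; split_ifs <;> norm_num) ζ
    refine Finset.sum_pos' (fun ζ _ => mul_nonneg (hnonneg ζ) (hnn ζ)) ⟨η, Finset.mem_univ _, ?_⟩
    refine mul_pos hη ?_
    obtain ⟨h0, h1⟩ := upProb_mem hp0 hp1 hq0 hq1 η
    rw [transition_apply]
    have hs : ∀ θ, (0 : ℝ) ≤ (Pi.single (push ε η) 1 : State L → ℝ) θ := fun θ => by
      rw [Pi.single_apply]; split_ifs <;> norm_num
    have h1' : 0 < 1 - upProb p q η := by linarith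
    rcases Int.units_eq_one_or ε with rfl | rfl
    · rw [Pi.single_eq_same]
      have := mul_nonneg h1'.le (hs (push (-1) η))
      linarith
    · rw [Pi.single_eq_same]
      have := mul_nonneg h0.le (hs (push 1 η))
      linarith
  · rw [hsum, hsum, hstat]
  · obtain ⟨h, hh⟩ := hpoisson f
    exact ⟨h, fun η => by rw [hsum]; exact hh η⟩

end Stationary

/-! ### Mean displacement; absence of drift in the symmetric case -/

lemma sum_mul_upProb_eq_speed (hL : 1 ≤ L) {p q : ℝ} {π : State L → ℝ} :
    ∑ η, π η * (2 * upProb p q η - 1) = speed p q π := by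
  classical
  unfold speed massMax massMin
  rw [Finset.mul_sum, Finset.mul_sum, ← Finset.sum_add_distrib]
  refine Finset.sum_congr rfl fun η _ => ?_
  have := not_isLocMax_and_isLocMin hL η
  unfold upProb
  by_cases h1 : IsLocMax η
  · have h2 : ¬ IsLocMin η := fun h => this ⟨h1, h⟩
    simp [h1, h2]
    ring
  · by_cases h2 : IsLocMin η
    · simp [h1, h2]
      ring
    · simp [h1, h2]

/-- Reflection exchanges local maxima and minima; with `q = 1 - p` it therefore also exchanges right
and left steps. -/
lemma upProb_neg (hL : 1 ≤ L) (p : ℝ) (η : State L) :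
    upProb p (1 - p) (-η) = 1 - upProb p (1 - p) η := by
  have := not_isLocMax_and_isLocMin hL η
  unfold upProb
  rw [isLocMax_neg, isLocMin_neg]
  by_cases h1 : IsLocMax η
  · have h2 : ¬ IsLocMin η := fun h => this ⟨h1, h⟩
    simp [h1, h2]
  · by_cases h2 : IsLocMin η
    · simp [h1, h2]
    · simp [h1, h2]
      norm_num

/-- The expected displacement of the walk in `n` steps from the state `η`. -/
noncomputable def meanDisplacement (p q : ℝ) : ℕ → State L → ℝ
  | 0 => 0
  | n + 1 => fun η =>
    2 * upProb p q η - 1 + transition p q (meanDisplacement p q n) η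

/-- In the symmetric case the walk has no drift, so the Poisson equation of the one-step drift has
a solution. -/
lemma exists_poisson_drift (hL : 1 ≤ L) {p : ℝ} (hp0 : 0 < p) (hp1 : p < 1) :
    ∃ h : State L → ℝ, ∀ η,
      2 * upProb p (1 - p) η - 1 = h η - transition p (1 - p) h η := by
  obtain ⟨π, -, hsum, hstat, hpois⟩ :=
    exists_stationary (L := L) hp0 hp1 (by linarith : 0 < 1 - p) (by linarith)
  obtain ⟨h, hh⟩ := hpois fun η => 2 * upProb p (1 - p) η - 1
  set c := ∑ ζ, π ζ * (2 * upProb p (1 - p) ζ - 1)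
  have hflip : ∀ η, transition p (1 - p) (fun ζ => h ζ + h (-ζ)) η =
      transition p (1 - p) h η + transition p (1 - p) h (-η) := by
    intro η
    simp only [transition_apply, upProb_neg hL]
    have a1 : push 1 (-η) = -push (-1) η := by rw [← push_neg, neg_neg]
    rw [a1, push_neg 1 η]
    ring
  -- Adding the Poisson equations at `η` and `-η` cancels the drifts. The constant left over has the
  -- form `g - P g`, whose stationary mean is zero.
  have h2 : ∀ η, -2 * c = (h η + h (-η)) -
      transition p (1 - p) (fun ζ => h ζ + h (-ζ)) η := by
    intro η
    rw [hflip]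
    have e1 := hh η
    have e2 := hh (-η)
    simp only [upProb_neg hL] at e2
    linarith
  have h3 : c = 0 := by
    have e := hstat fun ζ => h ζ + h (-ζ)
    have : ∑ η, π η * (-2 * c) = 0 := by
      rw [Finset.sum_congr rfl fun η _ => by rw [h2 η, mul_sub], Finset.sum_sub_distrib, e,
        sub_self]
    rw [← Finset.sum_mul, hsum] at this
    linarith
  exact ⟨h, fun η => by rw [← hh η, h3, sub_zero]⟩

/-- For a Poisson solution `h` of the drift, `h - V n` is the `n`-th iterate of the transition
operator on `h`, which does not increase the supremum. -/
lemma exists_abs_meanDisplacement_le (hL : 1 ≤ L) {p : ℝ} (hp0 : 0 < p) (hp1 : p < 1) :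
    ∃ C, ∀ n (η : State L), |meanDisplacement p (1 - p) n η| ≤ C := by
  obtain ⟨h, hh⟩ := exists_poisson_drift hL hp0 hp1
  obtain ⟨a, ha⟩ := Finite.exists_max fun η => |h η|
  have key : ∀ n (η : State L), |h η - meanDisplacement p (1 - p) n η| ≤ |h a| := by
    intro n
    induction n with
    | zero => intro η; simpa [meanDisplacement] using ha η
    | succ n ih =>
      intro η
      have e : h η - meanDisplacement p (1 - p) (n + 1) η =
          transition p (1 - p) (h - meanDisplacement p (1 - p) n) η := by
        rw [map_sub, Pi.sub_apply, meanDisplacement]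
        linarith [hh η]
      rw [e, abs_le]
      exact ⟨le_transition hp0 hp1 (by linarith) (by linarith) (fun ζ => (abs_le.mp (ih ζ)).1) η,
        transition_le hp0 hp1 (by linarith) (by linarith) (fun ζ => (abs_le.mp (ih ζ)).2) η⟩
  refine ⟨2 * |h a|, fun n η => ?_⟩
  have h1 := abs_le.mp (key n η)
  have h2 := abs_le.mp (ha η)
  rw [abs_le]
  constructor <;> linarith

/-! ### Coupling and monotonicity: the gain from a step to the right -/

/-- Two walks, in the states `η` and `ζ`, the first one being at present `2 * e` to the right of
the second one, and never having been to the left of it during the last `L` steps. -/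
def Dominates (e : ℤ) (η ζ : State L) : Prop :=
  ∀ j ≤ L, partialSum η j ≤ 2 * e + partialSum ζ j

lemma Dominates.nonneg {e : ℤ} {η ζ : State L} (h : Dominates e η ζ) : 0 ≤ e := by
  have := h 0 (Nat.zero_le _)
  simp at this
  linarith

lemma Dominates.push {e e' : ℤ} {η ζ : State L} (h : Dominates e η ζ) (ε δ : ℤˣ)
    (he : 2 * e' = 2 * e + ε - δ) (he' : 0 ≤ e') : Dominates e' (push ε η) (push δ ζ) := by
  intro j hj
  rcases j with _ | j
  · simp; exact he'
  · rw [partialSum_push _ _ (by omega), partialSum_push _ _ (by omega), he]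
    have := h j (by omega)
    linarith

/-- Smaller partial sums make a local maximum less likely and a local minimum more likely; for `p ≤
1 / 2` both changes favour a step to the right. -/
lemma upProb_anti {p : ℝ} (hp : p ≤ 1 / 2) {η ζ : State L}
    (h : ∀ j ≤ L, partialSum η j ≤ partialSum ζ j) :
    upProb p (1 - p) ζ ≤ upProb p (1 - p) η := by
  have h1 : IsLocMax η → IsLocMax ζ := fun H j hj hj' => (H j hj hj').trans (h j hj')
  have h2 : IsLocMin ζ → IsLocMin η := fun H j hj hj' => (h j hj').trans (H j hj hj')
  unfold upProb
  split_ifs <;> first | linarith | tauto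

lemma upProb_mono {p : ℝ} (hp : 1 / 2 ≤ p) {η ζ : State L}
    (h : ∀ j ≤ L, partialSum η j ≤ partialSum ζ j) :
    upProb p (1 - p) η ≤ upProb p (1 - p) ζ := by
  have h1 : IsLocMax η → IsLocMax ζ := fun H j hj hj' => (H j hj hj').trans (h j hj')
  have h2 : IsLocMin ζ → IsLocMin η := fun H j hj hj' => (h j hj').trans (H j hj hj')
  unfold upProb
  split_ifs <;> first | linarith | tauto

/-- The two walks can be coupled so that their order is kept for ever, hence also in the mean. The
induction averages over one coupled step. -/
lemma Dominates.meanDisplacement_nonneg {p : ℝ} (hp0 : 0 < p) (hp : p ≤ 1 / 2) (n : ℕ) :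
    ∀ {e : ℤ} {η ζ : State L}, Dominates e η ζ →
      0 ≤ 2 * (e : ℝ) + meanDisplacement p (1 - p) n η - meanDisplacement p (1 - p) n ζ := by
  induction n with
  | zero =>
    intro e η ζ h
    have : (0 : ℝ) ≤ e := by exact_mod_cast h.nonneg
    simpa [meanDisplacement] using this
  | succ n ih =>
    intro e η ζ h
    obtain ⟨a0, a1⟩ := upProb_mem hp0 (by linarith : p < 1) (by linarith : 0 < 1 - p)
      (by linarith) η
    obtain ⟨b0, b1⟩ := upProb_mem hp0 (by linarith : p < 1) (by linarith : 0 < 1 - p)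
      (by linarith) ζ
    simp only [meanDisplacement, transition_apply]
    have he := h.nonneg
    have hpp := ih (h.push (e' := e) 1 1 (by ring) he)
    have hmm := ih (h.push (e' := e) (-1) (-1) (by ring) he)
    have hpm := ih (h.push (e' := e + 1) 1 (-1) (by push_cast; ring) (by linarith))
    -- At a common position the steps are coupled monotonically: by `upProb_anti` the left walk
    -- never goes right alone. At distance at least 2 independent steps cannot make the walks cross.
    rcases he.eq_or_lt with rfl | he1
    · have hu : upProb p (1 - p) ζ ≤ upProb p (1 - p) η :=
        upProb_anti hp fun j hj => by simpa using h j hj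
      have t1 := mul_nonneg b0.le hpp
      have t2 := mul_nonneg (sub_nonneg.mpr a1.le) hmm
      have t3 := mul_nonneg (sub_nonneg.mpr hu) hpm
      push_cast at t1 t2 t3 ⊢
      linarith
    · have hmp := ih (h.push (e' := e - 1) (-1) 1 (by push_cast; ring) (by linarith))
      have t1 := mul_nonneg (mul_nonneg a0.le b0.le) hpp
      have t2 := mul_nonneg (mul_nonneg (sub_nonneg.mpr a1.le) (sub_nonneg.mpr b1.le)) hmm
      have t3 := mul_nonneg (mul_nonneg a0.le (sub_nonneg.mpr b1.le)) hpm
      have t4 := mul_nonneg (mul_nonneg (sub_nonneg.mpr a1.le) b0.le) hmp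
      push_cast at t1 t2 t3 t4 ⊢
      linarith

/-- With probability at least `p ^ 2` per step both walks go right. After `k` such steps their
states coincide, and from then on the mean distance stays `2 * e ≥ 2`; all other outcomes contribute
nonnegatively. -/
lemma Dominates.le_meanDisplacement {p : ℝ} (hp0 : 0 < p) (hp : p ≤ 1 / 2) (k : ℕ) :
    ∀ {e : ℤ} {η ζ : State L} {j n : ℕ}, Dominates e η ζ → 1 ≤ e → k ≤ n → j + k = L →
      (∀ i : Fin L, (i : ℕ) < j → η i = ζ i) →
      2 * (p ^ 2) ^ k ≤
        2 * (e : ℝ) + meanDisplacement p (1 - p) n η - meanDisplacement p (1 - p) n ζ := by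
  induction k with
  | zero =>
    intro e η ζ j n h he _ hj hag
    obtain rfl : η = ζ := funext fun i => hag i (by omega)
    have : (1 : ℝ) ≤ e := by exact_mod_cast he
    simpa using this
  | succ k ih =>
    intro e η ζ j n h he hn hj hag
    obtain ⟨n, rfl⟩ : ∃ m, n = m + 1 := ⟨n - 1, by omega⟩
    have hlow : ∀ θ : State L, p ≤ upProb p (1 - p) θ := fun θ => by
      unfold upProb; split_ifs <;> linarith
    obtain ⟨a0, a1⟩ := upProb_mem hp0 (by linarith : p < 1) (by linarith : 0 < 1 - p)
      (by linarith) η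
    obtain ⟨b0, b1⟩ := upProb_mem hp0 (by linarith : p < 1) (by linarith : 0 < 1 - p)
      (by linarith) ζ
    simp only [meanDisplacement, transition_apply]
    have hpp := ih (j := j + 1) (n := n) (h.push (e' := e) 1 1 (by ring) (by linarith)) he
      (by omega) (by omega) (fun i hi => by
        unfold PerturbedWalk.push
        split_ifs with h0
        · rfl
        · exact hag _ (by simp only; omega))
    have hmm := meanDisplacement_nonneg hp0 hp n
      (h.push (e' := e) (-1) (-1) (by ring) (by linarith))
    have hpm := meanDisplacement_nonneg hp0 hp n
      (h.push (e' := e + 1) 1 (-1) (by push_cast; ring) (by linarith))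
    have hmp := meanDisplacement_nonneg hp0 hp n
      (h.push (e' := e - 1) (-1) 1 (by push_cast; ring) (by linarith))
    have t0 : p ^ 2 ≤ upProb p (1 - p) η * upProb p (1 - p) ζ := by
      rw [sq]; exact mul_le_mul (hlow η) (hlow ζ) hp0.le a0.le
    have t1 := mul_le_mul t0 hpp (by positivity) (mul_pos a0 b0).le
    have t2 := mul_nonneg (mul_nonneg (sub_nonneg.mpr a1.le) (sub_nonneg.mpr b1.le)) hmm
    have t3 := mul_nonneg (mul_nonneg a0.le (sub_nonneg.mpr b1.le)) hpm
    have t4 := mul_nonneg (mul_nonneg (sub_nonneg.mpr a1.le) b0.le) hmp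
    rw [pow_succ]
    push_cast at t1 t2 t3 t4 ⊢
    linarith

/-- For `p ≥ 1 / 2` the chain preserves the coordinatewise order of states, so the walk with more
right steps behind it drifts at least as far. -/
lemma meanDisplacement_mono {p : ℝ} (hp : 1 / 2 ≤ p) (hp1 : p < 1) (n : ℕ) :
    ∀ {η ζ : State L}, (∀ i, (η i : ℤ) ≤ ζ i) →
      meanDisplacement p (1 - p) n η ≤ meanDisplacement p (1 - p) n ζ := by
  have hpush : ∀ {η ζ : State L} {ε δ : ℤˣ}, (∀ i, (η i : ℤ) ≤ ζ i) → (ε : ℤ) ≤ δ →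
      ∀ i, (push ε η i : ℤ) ≤ push δ ζ i := by
    intro η ζ ε δ h he i
    unfold push
    split_ifs
    · exact he
    · exact h _
  induction n with
  | zero => intro η ζ _; simp [meanDisplacement]
  | succ n ih =>
    intro η ζ h
    obtain ⟨a0, a1⟩ := upProb_mem (by linarith : 0 < p) hp1 (by linarith : 0 < 1 - p)
      (by linarith) η
    obtain ⟨b0, b1⟩ := upProb_mem (by linarith : 0 < p) hp1 (by linarith : 0 < 1 - p)
      (by linarith) ζ
    simp only [meanDisplacement, transition_apply]
    have hu : upProb p (1 - p) η ≤ upProb p (1 - p) ζ := upProb_mono hp fun j _ => by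
      unfold partialSum
      refine Finset.sum_le_sum fun i _ => ?_
      split_ifs
      · exact h i
      · exact le_rfl
    have t1 := mul_nonneg a0.le (sub_nonneg.mpr (ih (hpush (ε := 1) (δ := 1) h le_rfl)))
    have t2 := mul_nonneg (sub_nonneg.mpr b1.le)
      (sub_nonneg.mpr (ih (hpush (ε := -1) (δ := -1) h le_rfl)))
    have t3 := mul_nonneg (sub_nonneg.mpr hu)
      (sub_nonneg.mpr (ih (hpush (ε := -1) (δ := 1) h (by decide))))
    linarith

/-- In the symmetric case an initial step to the right instead of to the left makes the walk gain
a distance bounded below at all later times. -/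
lemma exists_le_gain {p : ℝ} (hp0 : 0 < p) (hp1 : p < 1) :
    ∃ δ > 0, ∀ n, L ≤ n → ∀ η : State L,
      δ ≤ 2 + meanDisplacement p (1 - p) n (push 1 η) -
        meanDisplacement p (1 - p) n (push (-1) η) := by
  rcases le_total p (1 / 2) with hp | hp
  · refine ⟨2 * (p ^ 2) ^ L, by positivity, fun n hn η => ?_⟩
    have hd : Dominates 0 η η := fun j _ => by simp
    have := (hd.push (e' := 1) 1 (-1) (by norm_num) (by norm_num)).le_meanDisplacement hp0 hp L
      (j := 0) le_rfl hn (by omega) (fun i hi => absurd hi (Nat.not_lt_zero _))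
    simpa using this
  · refine ⟨2, by norm_num, fun n _ η => ?_⟩
    have := meanDisplacement_mono (L := L) hp hp1 n (η := push (-1) η) (ζ := push 1 η) fun i => by
      unfold push
      split_ifs
      · decide
      · exact le_rfl
    linarith

/-! ### The sign of the speed -/

lemma massMin_pos {π : State L → ℝ} (hπ : ∀ η, 0 < π η) : 0 < massMin π := by
  classical
  unfold massMin
  refine Finset.sum_pos' (fun η _ => ?_) ⟨fun _ => -1, Finset.mem_univ _, ?_⟩
  · split_ifs
    · exact (hπ η).le
    · exact le_rfl
  · rw [if_pos]
    · exact hπ _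
    · intro j _ _
      unfold partialSum
      refine Finset.sum_nonpos fun i _ => ?_
      split_ifs <;> simp

open Classical in
/-- The change of `∑ η, π η * meanDisplacement p (1 - p) n η` in one step. -/
lemma sum_meanDisplacement_succ (hL : 1 ≤ L) {p q : ℝ} {π : State L → ℝ}
    (hstat : ∀ f : State L → ℝ, ∑ η, π η * transition p q f η = ∑ η, π η * f η) (n : ℕ) :
    ∑ η, π η * meanDisplacement p (1 - p) (n + 1) η =
      ∑ η, π η * meanDisplacement p (1 - p) n η + speed p q π -
        (p + q - 1) * ∑ η, (if IsLocMin η then π η else 0) *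
          (2 + meanDisplacement p (1 - p) n (push 1 η) -
            meanDisplacement p (1 - p) n (push (-1) η)) := by
  rw [← hstat (meanDisplacement p (1 - p) n), ← sum_mul_upProb_eq_speed hL, Finset.mul_sum, ← Finset.sum_add_distrib,
    ← Finset.sum_sub_distrib]
  refine Finset.sum_congr rfl fun η _ => ?_
  have := not_isLocMax_and_isLocMin hL η
  simp only [meanDisplacement, transition_apply, upProb]
  -- Only at a local minimum do the two chains differ: the probability of a right step is `1 - p` in
  -- one and `q` in the other.
  by_cases h1 : IsLocMax η
  · have h2 : ¬ IsLocMin η := fun h => this ⟨h1, h⟩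
    simp only [h1, h2, if_true, if_false]
    ring
  · by_cases h2 : IsLocMin η
    · simp only [h1, h2, if_true, if_false]
      ring
    · simp only [h1, h2, if_false]
      ring

/-- A sequence whose increments are eventually at least `a > 0` is unbounded. -/
lemma nonpos_of_bounded_of_add_le {A : ℕ → ℝ} {a C : ℝ} {N : ℕ} (hA : ∀ n, |A n| ≤ C)
    (h : ∀ n ≥ N, A n + a ≤ A (n + 1)) : a ≤ 0 := by
  by_contra! ha
  have key : ∀ n : ℕ, A N + n * a ≤ A (N + n) := by
    intro n
    induction n with
    | zero => simp
    | succ n ih =>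
      have := h (N + n) (by omega)
      rw [← add_assoc]
      push_cast
      linarith
  obtain ⟨n, hn⟩ := exists_nat_gt (2 * C / a)
  rw [div_lt_iff₀ ha] at hn
  linarith [key n, (abs_le.mp (hA N)).1, (abs_le.mp (hA (N + n))).2]

lemma speed_sign (hL : 1 ≤ L) {p q : ℝ} (hp0 : 0 < p) (hp1 : p < 1) {π : State L → ℝ}
    (hπ : ∀ η, 0 < π η) (hsum : ∑ η, π η = 1)
    (hstat : ∀ f : State L → ℝ, ∑ η, π η * transition p q f η = ∑ η, π η * f η) :
    (speed p q π < 0 ↔ p + q - 1 < 0) ∧ (speed p q π = 0 ↔ p + q - 1 = 0) ∧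
      (0 < speed p q π ↔ 0 < p + q - 1) := by
  classical
  obtain ⟨C, hC⟩ := exists_abs_meanDisplacement_le (L := L) hL hp0 hp1
  obtain ⟨δ, hδ, hgain⟩ := exists_le_gain (L := L) hp0 hp1
  set A : ℕ → ℝ := fun n => ∑ η, π η * meanDisplacement p (1 - p) n η
  have hA : ∀ n, |A n| ≤ C := fun n => by
    calc |A n| ≤ ∑ η, |π η * meanDisplacement p (1 - p) n η| := Finset.abs_sum_le_sum_abs _ _
      _ ≤ ∑ η, π η * C := Finset.sum_le_sum fun η _ => by
        rw [abs_mul, abs_of_pos (hπ η)]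
        exact mul_le_mul_of_nonneg_left (hC n η) (hπ η).le
      _ = C := by rw [← Finset.sum_mul, hsum, one_mul]
  have hAn : ∀ n, |-A n| ≤ C := fun n => by rw [abs_neg]; exact hA n
  set G : ℕ → ℝ := fun n => ∑ η : State L, (if IsLocMin η then π η else 0) *
    (2 + meanDisplacement p (1 - p) n (push 1 η) -
      meanDisplacement p (1 - p) n (push (-1) η))
  have hstep : ∀ n, A (n + 1) = A n + speed p q π - (p + q - 1) * G n := fun n => by
    convert sum_meanDisplacement_succ hL hstat n
  have hm := massMin_pos hπ
  have hG : ∀ n ≥ L, massMin π * δ ≤ G n := by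
    intro n hn
    unfold massMin
    rw [Finset.sum_mul]
    refine Finset.sum_le_sum fun η _ => ?_
    refine mul_le_mul_of_nonneg_left (hgain n hn η) ?_
    split_ifs
    · exact (hπ η).le
    · exact le_rfl
  have hmδ := mul_pos hm hδ
  -- In fact `speed ≥ (p + q - 1) * (massMin π * δ)`: any shortfall would make `-A` grow linearly.
  have hpos : 0 < p + q - 1 → 0 < speed p q π := by
    intro h
    have := nonpos_of_bounded_of_add_le (a := (p + q - 1) * (massMin π * δ) - speed p q π)
      (N := L) hAn fun n hn => by
        rw [hstep]
        linarith [mul_le_mul_of_nonneg_left (hG n hn) h.le]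
    linarith [mul_pos h hmδ]
  have hneg : p + q - 1 < 0 → speed p q π < 0 := by
    intro h
    have := nonpos_of_bounded_of_add_le (a := speed p q π - (p + q - 1) * (massMin π * δ))
      (N := L) hA fun n hn => by
        rw [hstep]
        linarith [mul_le_mul_of_nonpos_left (hG n hn) h.le]
    linarith [mul_neg_of_neg_of_pos h hmδ]
  have hzero : p + q - 1 = 0 → speed p q π = 0 := by
    intro h
    refine le_antisymm (nonpos_of_bounded_of_add_le (N := 0) hA fun n _ => ?_)
      (neg_nonpos.mp (nonpos_of_bounded_of_add_le (N := 0) hAn fun n _ => ?_))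
    · rw [hstep, h]
      linarith
    · rw [hstep, h]
      linarith
  rcases lt_trichotomy (p + q - 1) 0 with h | h | h
  · have := hneg h
    refine ⟨⟨fun _ => h, fun _ => this⟩, ⟨?_, ?_⟩, ⟨?_, ?_⟩⟩ <;> intro <;> linarith
  · have := hzero h
    refine ⟨⟨?_, ?_⟩, ⟨fun _ => h, fun _ => this⟩, ⟨?_, ?_⟩⟩ <;> intro <;> linarith
  · have := hpos h
    refine ⟨⟨?_, ?_⟩, ⟨?_, ?_⟩, ⟨fun _ => h, fun _ => this⟩⟩ <;> intro <;> linarith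

/-! ### From paths to states -/

/-- The direction of the last `L` steps of the path `x` before time `k`. -/
def window (L : ℕ) (x : ℕ → ℤ) (k : ℕ) : State L := fun i =>
  if x (k - i) - x (k - i - 1) = 1 then 1 else -1

lemma window_congr {x y : ℕ → ℤ} {k : ℕ} (h : ∀ j ≤ k, x j = y j) :
    window L x k = window L y k := by
  funext i
  unfold window
  rw [h (k - i) (by omega), h (k - i - 1) (by omega)]

lemma window_succ (x : ℕ → ℤ) (k : ℕ) :
    window L x (k + 1) = push (if x (k + 1) = x k + 1 then 1 else -1) (window L x k) := by
  funext i
  unfold push window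
  by_cases h0 : (i : ℕ) = 0
  · simp only [h0, if_true, Nat.sub_zero, Nat.add_sub_cancel]
    exact if_congr (by omega) rfl rfl
  · simp only [h0, if_false]
    rw [show k + 1 - (i : ℕ) = k - (i - 1) by omega]

/-- The path `x` is a nearest-neighbour path up to time `k`. -/
def NearestNeighbour (x : ℕ → ℤ) (k : ℕ) : Prop :=
  ∀ j < k, x (j + 1) = x j + 1 ∨ x (j + 1) = x j - 1

lemma NearestNeighbour.window_apply {x : ℕ → ℤ} {k : ℕ} (hx : NearestNeighbour x k) (hk : L ≤ k)
    (i : Fin L) : (window L x k i : ℤ) = x (k - i) - x (k - i - 1) := by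
  have h := hx (k - i - 1) (by omega)
  rw [show k - (i : ℕ) - 1 + 1 = k - i by omega] at h
  unfold window
  split_ifs with h1
  · rw [h1]; rfl
  · simp only [Units.val_neg, Units.val_one]
    omega

lemma NearestNeighbour.hasState_iff {x : ℕ → ℤ} {k : ℕ} (hx : NearestNeighbour x k) (hk : L ≤ k)
    (η : State L) : HasState x k η ↔ window L x k = η := by
  unfold HasState
  rw [funext_iff]
  refine forall_congr' fun i => ?_
  rw [← hx.window_apply hk, Units.val_inj]

lemma partialSum_succ (η : State L) {j : ℕ} (hj : j < L) :
    partialSum η (j + 1) = partialSum η j + η ⟨j, hj⟩ := by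
  have h : ((η ⟨j, hj⟩ : ℤˣ) : ℤ) = ∑ i : Fin L, if i = ⟨j, hj⟩ then (η i : ℤ) else 0 := by
    simp
  rw [h]
  unfold partialSum
  rw [← Finset.sum_add_distrib]
  refine Finset.sum_congr rfl fun i _ => ?_
  simp only [Fin.ext_iff]
  split_ifs <;> omega

lemma NearestNeighbour.partialSum_window {x : ℕ → ℤ} {k : ℕ} (hx : NearestNeighbour x k)
    (hk : L ≤ k) (j : ℕ) (hj : j ≤ L) : partialSum (window L x k) j = x k - x (k - j) := by
  induction j with
  | zero => simp
  | succ j ih =>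
    rw [partialSum_succ _ (by omega), ih (by omega), hx.window_apply hk, Nat.sub_sub]
    ring

/-- Once `k ≥ L` the lookback is exactly `L` steps, and since `L ≥ 1` and consecutive positions
differ, the clause for a simultaneous maximum and minimum is void. -/
lemma NearestNeighbour.stepUp_eq {x : ℕ → ℤ} {k : ℕ} (hx : NearestNeighbour x k) (hL : 1 ≤ L)
    (hk : L ≤ k) (p q : ℝ) : stepUp L p q x k = upProb p q (window L x k) := by
  have hmax : AtMax L x k ↔ IsLocMax (window L x k) := by
    unfold AtMax IsLocMax
    rw [min_eq_left hk]
    refine ⟨fun h j _ hj => ?_, fun h j hj => ?_⟩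
    · rw [hx.partialSum_window hk j hj]
      linarith [h j hj]
    · rcases Nat.eq_zero_or_pos j with rfl | h0
      · simp
      · have := h j h0 hj
        rw [hx.partialSum_window hk j hj] at this
        linarith
  have hmin : AtMin L x k ↔ IsLocMin (window L x k) := by
    unfold AtMin IsLocMin
    rw [min_eq_left hk]
    refine ⟨fun h j _ hj => ?_, fun h j hj => ?_⟩
    · rw [hx.partialSum_window hk j hj]
      linarith [h j hj]
    · rcases Nat.eq_zero_or_pos j with rfl | h0
      · simp
      · have := h j h0 hj
        rw [hx.partialSum_window hk j hj] at this
        linarith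
  unfold stepUp upProb
  rw [hmax, hmin, if_neg (not_isLocMax_and_isLocMin hL _)]

/-! ### The law of large numbers for the occupation of states -/

section Trajectory

variable {Ω : Type*}

/-- `G` is a function of the trajectory of `X` up to time `k`. -/
def DeterminedUpTo (X : ℕ → Ω → ℤ) (k : ℕ) (G : Ω → ℝ) : Prop :=
  ∀ ω ω', (∀ j ≤ k, X j ω = X j ω') → G ω = G ω'

/-- The trajectory up to time `k`. -/
def trajectory (X : ℕ → Ω → ℤ) (k : ℕ) (ω : Ω) : Fin (k + 1) → ℤ := fun j => X j ω

lemma trajectory_eq_iff {X : ℕ → Ω → ℤ} {k : ℕ} {ω ω' : Ω} :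
    trajectory X k ω = trajectory X k ω' ↔ ∀ j ≤ k, X j ω = X j ω' := by
  rw [funext_iff]
  exact ⟨fun h j hj => h ⟨j, by omega⟩, fun h j => h j (by omega)⟩

lemma determinedUpTo_window (X : ℕ → Ω → ℤ) (φ : State L → ℝ) {j k : ℕ} (hjk : j ≤ k) :
    DeterminedUpTo X k fun ω => φ (window L (fun m => X m ω) j) := fun ω ω' h => by
  simp only
  rw [window_congr fun m hm => h m (hm.trans hjk)]

variable [MeasurableSpace Ω] {μ : Measure Ω} {X : ℕ → Ω → ℤ} {p q : ℝ}

lemma measurable_trajectory (hX : ∀ k, Measurable (X k)) (k : ℕ) :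
    Measurable (trajectory X k) :=
  measurable_pi_lambda _ fun j => hX j

/-- Such a function factors through the trajectory, which takes values in a countable discrete
space. -/
lemma DeterminedUpTo.measurable (hX : ∀ k, Measurable (X k)) {k : ℕ} {G : Ω → ℝ}
    (hG : DeterminedUpTo X k G) : Measurable G := by
  have hf : Function.FactorsThrough G (trajectory X k) := fun ω ω' h =>
    hG ω ω' (trajectory_eq_iff.mp h)
  have : G = Function.extend (trajectory X k) G 0 ∘ trajectory X k :=
    funext fun ω => (hf.extend_apply 0 ω).symm
  rw [this]
  exact (Measurable.of_discrete).comp (measurable_trajectory hX k)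

variable [IsProbabilityMeasure μ]

lemma IsPerturbedWalk.ae_step (h : IsPerturbedWalk μ L p q X) (k : ℕ) :
    ∀ᵐ ω ∂μ, X (k + 1) ω = X k ω + 1 ∨ X (k + 1) ω = X k ω - 1 := by
  have hW := measurable_trajectory h.measurable k
  have key : ∀ w : Fin (k + 1) → ℤ, ∀ᵐ ω ∂μ, trajectory X k ω = w →
      (X (k + 1) ω = X k ω + 1 ∨ X (k + 1) ω = X k ω - 1) := by
    intro w
    by_cases hw : ∃ ω₀, trajectory X k ω₀ = w
    · obtain ⟨ω₀, rfl⟩ := hw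
      set x : ℕ → ℤ := fun j => X j ω₀
      set B : Set Ω := {ω | ∀ j ≤ k, X j ω = x j}
      have hBm : MeasurableSet B := by
        have : B = trajectory X k ⁻¹' {trajectory X k ω₀} := by
          ext ω; exact trajectory_eq_iff.symm
        rw [this]
        exact hW (measurableSet_singleton _)
      have hUm : ∀ a, MeasurableSet {ω | X (k + 1) ω = a} := fun a =>
        h.measurable _ (measurableSet_singleton a)
      have h1 : μ.real (B ∩ {ω | X (k + 1) ω = x k + 1}) = _ := h.step_right k x
      have h2 : μ.real (B ∩ {ω | X (k + 1) ω = x k - 1}) = _ := h.step_left k x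
      have hd : Disjoint (B ∩ {ω | X (k + 1) ω = x k + 1})
          (B ∩ {ω | X (k + 1) ω = x k - 1}) := by
        rw [Set.disjoint_left]
        rintro ω ⟨-, ha⟩ ⟨-, hb⟩
        simp only [Set.mem_ofPred_eq] at ha hb
        omega
      have h3 := measureReal_union (μ := μ) hd (hBm.inter (hUm _))
      set V := B ∩ {ω | X (k + 1) ω = x k + 1} ∪ B ∩ {ω | X (k + 1) ω = x k - 1}
      have hVm : MeasurableSet V := (hBm.inter (hUm _)).union (hBm.inter (hUm _))
      have hVB : V ⊆ B := Set.union_subset Set.inter_subset_left Set.inter_subset_left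
      have h4 : μ.real (B \ V) = 0 := by
        rw [measureReal_sdiff hVB hVm, h3, h1, h2]
        ring
      have h5 : μ (B \ V) = 0 := (measureReal_eq_zero_iff).mp h4
      filter_upwards [measure_eq_zero_iff_ae_notMem.mp h5] with ω hω hωw
      have hωB : ω ∈ B := trajectory_eq_iff.mp hωw
      have hωV : ω ∈ V := by
        by_contra hn
        exact hω ⟨hωB, hn⟩
      rw [hωB k le_rfl]
      exact hωV.imp (fun t => t.2) fun t => t.2
    · exact Eventually.of_forall fun ω hω => absurd ⟨ω, hω⟩ hw
  filter_upwards [ae_all_iff.mpr key] with ω hω using hω _ rfl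

lemma IsPerturbedWalk.ae_nearestNeighbour (h : IsPerturbedWalk μ L p q X) :
    ∀ᵐ ω ∂μ, ∀ k, NearestNeighbour (fun j => X j ω) k := by
  filter_upwards [ae_all_iff.mpr h.ae_step] with ω hω k j _ using hω j

/-- The Markov property of the chain of the last `L` steps, in integrated form. -/
lemma IsPerturbedWalk.integral_mul_sub_transition (h : IsPerturbedWalk μ L p q X) (hL : 1 ≤ L)
    {k : ℕ} (hk : L ≤ k) (φ : State L → ℝ) {G : Ω → ℝ} (hG : DeterminedUpTo X k G) {C : ℝ}
    (hGC : ∀ ω, |G ω| ≤ C) :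
    ∫ ω, G ω * (φ (window L (fun j => X j ω) (k + 1)) -
      transition p q φ (window L (fun j => X j ω) k)) ∂μ = 0 := by
  set F : Ω → ℝ := fun ω => G ω * (φ (window L (fun j => X j ω) (k + 1)) -
      transition p q φ (window L (fun j => X j ω) k)) with hF
  have hW := measurable_trajectory h.measurable k
  obtain ⟨a, ha⟩ := Finite.exists_max fun η => |φ η|
  obtain ⟨b, hb⟩ := Finite.exists_max fun η => |transition p q φ η|
  have hφm := (determinedUpTo_window X φ (le_refl (k + 1))).measurable h.measurable
  have hPm := (determinedUpTo_window X (transition p q φ) (le_refl k)).measurable h.measurable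
  have hFint : Integrable F μ := by
    refine Integrable.of_bound
      ((hG.measurable h.measurable).mul (hφm.sub hPm)).aestronglyMeasurable
      (C * (|φ a| + |transition p q φ b|)) (Eventually.of_forall fun ω => ?_)
    rw [Real.norm_eq_abs, abs_mul]
    exact mul_le_mul (hGC ω) ((abs_sub _ _).trans (add_le_add (ha _) (hb _))) (abs_nonneg _)
      ((abs_nonneg _).trans (hGC ω))
  have hU : ⋃ w, trajectory X k ⁻¹' {w} = Set.univ := by
    ext ω; simp
  have hmeas : ∀ w, MeasurableSet (trajectory X k ⁻¹' {w}) := fun w =>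
    hW (measurableSet_singleton w)
  -- Conditioning on the past is a countable sum over initial trajectories; those that are not
  -- nearest-neighbour form a null set.
  rw [← setIntegral_univ, ← hU, integral_iUnion hmeas ?_ hFint.integrableOn]
  · rw [← tsum_zero (α := ℝ) (β := Fin (k + 1) → ℤ)]
    congr 1
    funext w
    by_cases hw : ∃ ω₀, trajectory X k ω₀ = w ∧ NearestNeighbour (fun j => X j ω₀) k
    · obtain ⟨ω₀, rfl, hω₀⟩ := hw
      set x : ℕ → ℤ := fun j => X j ω₀ with hx
      have hB : trajectory X k ⁻¹' {trajectory X k ω₀} = {ω | ∀ j ≤ k, X j ω = x j} := by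
        ext ω; exact trajectory_eq_iff
      have hBm := hmeas (trajectory X k ω₀)
      rw [hB] at hBm ⊢
      set B : Set Ω := {ω | ∀ j ≤ k, X j ω = x j}
      set U : Set Ω := {ω | X (k + 1) ω = x k + 1} with hUdef
      have hUm : MeasurableSet U := h.measurable _ (measurableSet_singleton _)
      set η := window L x k
      have h1 : μ.real (B ∩ U) = stepUp L p q x k * μ.real B := h.step_right k x
      rw [hω₀.stepUp_eq hL hk] at h1
      have e1 : ∀ ω ∈ B, F ω = G ω₀ * (φ (push (-1) η) - transition p q φ η) +
          U.indicator (fun _ => G ω₀ * (φ (push 1 η) - φ (push (-1) η))) ω := by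
        intro ω hω
        have hwin : window L (fun j => X j ω) k = η := window_congr hω
        simp only [hF]
        rw [hG ω ω₀ hω, window_succ, hwin, hω k le_rfl]
        by_cases hωU : X (k + 1) ω = x k + 1
        · rw [if_pos hωU, Set.indicator_of_mem (show ω ∈ U from hωU)]
          ring
        · rw [if_neg hωU, Set.indicator_of_notMem (show ω ∉ U from hωU)]
          ring
      rw [setIntegral_congr_fun hBm e1, integral_add (integrable_const _)
        ((integrable_const _).indicator hUm), integral_indicator_const _ hUm, integral_const,
        measureReal_restrict_apply hUm, measureReal_restrict_apply MeasurableSet.univ,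
        Set.univ_inter, Set.inter_comm, h1, transition_apply, smul_eq_mul, smul_eq_mul]
      ring
    · refine setIntegral_eq_zero_of_ae_eq_zero ?_
      filter_upwards [h.ae_nearestNeighbour] with ω hω hωw
      exact absurd ⟨ω, hωw, hω k⟩ hw
  · intro w w' hne
    exact Disjoint.preimage _ (Set.disjoint_singleton.mpr hne)

/-- The martingale that belongs to the function `φ` of the last `L` steps. -/
noncomputable def dynkin (L : ℕ) (p q : ℝ) (X : ℕ → Ω → ℤ) (φ : State L → ℝ) (n : ℕ) (ω : Ω) : ℝ :=
  ∑ i ∈ Finset.range n, (φ (window L (fun j => X j ω) (L + i + 1)) -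
    transition p q φ (window L (fun j => X j ω) (L + i)))

omit [MeasurableSpace Ω] in
lemma determinedUpTo_dynkin (φ : State L → ℝ) (n : ℕ) :
    DeterminedUpTo X (L + n) (dynkin L p q X φ n) := fun ω ω' hω => by
  unfold dynkin
  refine Finset.sum_congr rfl fun i hi => ?_
  rw [Finset.mem_range] at hi
  have h1 := determinedUpTo_window X φ (show L + i + 1 ≤ L + n by omega) ω ω' hω
  have h2 := determinedUpTo_window X (transition p q φ) (show L + i ≤ L + n by omega) ω ω' hω
  simp only at h1 h2
  rw [h1, h2]

/-- The martingale increments are bounded and orthogonal to the past, so the second moment grows at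
most linearly. -/
lemma IsPerturbedWalk.exists_integral_dynkin_sq_le (h : IsPerturbedWalk μ L p q X) (hL : 1 ≤ L)
    (φ : State L → ℝ) :
    ∃ C, ∀ n : ℕ, Integrable (fun ω => dynkin L p q X φ n ω ^ 2) μ ∧
      ∫ ω, dynkin L p q X φ n ω ^ 2 ∂μ ≤ n * C := by
  obtain ⟨a, ha⟩ := Finite.exists_max fun η => |φ η|
  obtain ⟨b, hb⟩ := Finite.exists_max fun η => |transition p q φ η|
  set c := |φ a| + |transition p q φ b|
  have hc0 : 0 ≤ c := by positivity
  set ξ : ℕ → Ω → ℝ := fun i ω => φ (window L (fun j => X j ω) (L + i + 1)) -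
    transition p q φ (window L (fun j => X j ω) (L + i))
  have hξ : ∀ i ω, |ξ i ω| ≤ c := fun i ω => (abs_sub _ _).trans (add_le_add (ha _) (hb _))
  have hM : ∀ n ω, |dynkin L p q X φ n ω| ≤ n * c := fun n ω => by
    refine (Finset.abs_sum_le_sum_abs _ _).trans ((Finset.sum_le_sum fun i _ => hξ i ω).trans ?_)
    simp
  have hmeasM : ∀ n, Measurable (dynkin L p q X φ n) := fun n =>
    (determinedUpTo_dynkin φ n).measurable h.measurable
  have hmeasξ : ∀ n, Measurable (ξ n) := fun n =>
    ((determinedUpTo_window X φ le_rfl).measurable h.measurable).sub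
      ((determinedUpTo_window X (transition p q φ) le_rfl).measurable h.measurable)
  have hintM : ∀ n, Integrable (fun ω => dynkin L p q X φ n ω ^ 2) μ := fun n => by
    refine Integrable.of_bound ((hmeasM n).pow_const 2).aestronglyMeasurable ((n * c) ^ 2)
      (Eventually.of_forall fun ω => ?_)
    rw [norm_pow, Real.norm_eq_abs]
    exact pow_le_pow_left₀ (abs_nonneg _) (hM n ω) 2
  have hsqle : ∀ n ω, ξ n ω ^ 2 ≤ c ^ 2 := fun n ω => sq_le_sq' (abs_le.mp (hξ n ω)).1
    (abs_le.mp (hξ n ω)).2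
  have hintξ : ∀ n, Integrable (fun ω => ξ n ω ^ 2) μ := fun n => by
    refine Integrable.of_bound ((hmeasξ n).pow_const 2).aestronglyMeasurable (c ^ 2)
      (Eventually.of_forall fun ω => ?_)
    rw [Real.norm_eq_abs, abs_of_nonneg (sq_nonneg _)]
    exact hsqle n ω
  have hintMξ : ∀ n, Integrable (fun ω => dynkin L p q X φ n ω * ξ n ω) μ := fun n => by
    refine Integrable.of_bound ((hmeasM n).mul (hmeasξ n)).aestronglyMeasurable (n * c * c)
      (Eventually.of_forall fun ω => ?_)
    rw [Real.norm_eq_abs, abs_mul]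
    exact mul_le_mul (hM n ω) (hξ n ω) (abs_nonneg _) (by positivity)
  refine ⟨c ^ 2, fun n => ⟨hintM n, ?_⟩⟩
  induction n with
  | zero => simp [dynkin]
  | succ n ih =>
    have e : ∀ ω, dynkin L p q X φ (n + 1) ω ^ 2 =
        dynkin L p q X φ n ω ^ 2 + 2 * (dynkin L p q X φ n ω * ξ n ω) + ξ n ω ^ 2 := fun ω => by
      unfold dynkin
      rw [Finset.sum_range_succ]
      ring
    simp_rw [e]
    have hadd : Integrable (fun ω => dynkin L p q X φ n ω ^ 2 +
        2 * (dynkin L p q X φ n ω * ξ n ω)) μ := (hintM n).add ((hintMξ n).const_mul 2)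
    rw [integral_add hadd (hintξ n),
      integral_add (hintM n) ((hintMξ n).const_mul 2), integral_const_mul,
      h.integral_mul_sub_transition hL (by omega) φ (determinedUpTo_dynkin φ n) (hM n)]
    have hle : ∫ ω, ξ n ω ^ 2 ∂μ ≤ c ^ 2 := by
      refine (integral_mono (hintξ n) (integrable_const _) (hsqle n)).trans ?_
      simp
    push_cast
    linarith

/-- Along the squares the second moments are at most `C / n ^ 2`, hence summable; so the squares of
the quotients are almost surely summable. -/
lemma IsPerturbedWalk.ae_tendsto_dynkin_div (h : IsPerturbedWalk μ L p q X) (hL : 1 ≤ L)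
    (φ : State L → ℝ) :
    ∀ᵐ ω ∂μ, Tendsto (fun n : ℕ => dynkin L p q X φ (n ^ 2) ω / ((n ^ 2 : ℕ) : ℝ)) atTop (𝓝 0) := by
  obtain ⟨C, hC⟩ := h.exists_integral_dynkin_sq_le hL φ
  set Z : ℕ → Ω → ℝ := fun n ω => dynkin L p q X φ (n ^ 2) ω / ((n ^ 2 : ℕ) : ℝ) with hZ
  have hZm : ∀ n, Measurable (Z n) := fun n =>
    ((determinedUpTo_dynkin φ (n ^ 2)).measurable h.measurable).div_const _
  have hle : ∀ n, ∫⁻ ω, ENNReal.ofReal (Z n ω ^ 2) ∂μ ≤ ENNReal.ofReal (C * (1 / (n : ℝ) ^ 2)) := by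
    intro n
    have e : ∀ ω, Z n ω ^ 2 = dynkin L p q X φ (n ^ 2) ω ^ 2 / ((n ^ 2 : ℕ) : ℝ) ^ 2 := fun ω =>
      div_pow _ _ _
    rw [← ofReal_integral_eq_lintegral_ofReal]
    · refine ENNReal.ofReal_le_ofReal ?_
      simp_rw [e]
      rw [integral_div]
      rcases Nat.eq_zero_or_pos n with rfl | hn
      · simp
      · have hn' : (0 : ℝ) < n := by exact_mod_cast hn
        rw [div_le_iff₀ (by positivity)]
        refine (hC (n ^ 2)).2.trans (le_of_eq ?_)
        push_cast
        field_simp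
    · simp_rw [e]
      exact (hC (n ^ 2)).1.div_const _
    · exact Eventually.of_forall fun ω => sq_nonneg _
  have hC0 : 0 ≤ C := by
    have h1 := (hC 1).2
    have h2 : 0 ≤ ∫ ω, dynkin L p q X φ 1 ω ^ 2 ∂μ := integral_nonneg fun ω => sq_nonneg _
    push_cast at h1
    linarith
  have hsum : ∫⁻ ω, ∑' n, ENNReal.ofReal (Z n ω ^ 2) ∂μ ≠ ⊤ := by
    rw [lintegral_tsum fun n => ((hZm n).pow_const 2).ennreal_ofReal.aemeasurable]
    refine ne_top_of_le_ne_top ?_ (ENNReal.tsum_le_tsum hle)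
    have hs : Summable fun n : ℕ => C * (1 / (n : ℝ) ^ 2) :=
      (Real.summable_one_div_nat_pow.mpr one_lt_two).mul_left C
    rw [← ENNReal.ofReal_tsum_of_nonneg (fun n => by positivity) hs]
    exact ENNReal.ofReal_ne_top
  filter_upwards [ae_lt_top (Measurable.tsum fun n =>
    ((hZm n).pow_const 2).ennreal_ofReal) hsum] with ω hω
  have h1 := ENNReal.tendsto_atTop_zero_of_tsum_ne_top hω.ne
  have h2 := (ENNReal.tendsto_toReal ENNReal.zero_ne_top).comp h1
  have h3 : Tendsto (fun n => Z n ω ^ 2) atTop (𝓝 0) := by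
    refine h2.congr fun n => ?_
    exact ENNReal.toReal_ofReal (sq_nonneg _)
  have h4 := h3.sqrt
  rw [Real.sqrt_zero] at h4
  refine (tendsto_zero_iff_abs_tendsto_zero _).mpr (h4.congr fun n => ?_)
  exact Real.sqrt_sq_eq_abs _

/-- For counting functions the convergence of the frequencies follows from the one along the
squares. -/
lemma tendsto_div_of_monotone_of_tendsto_sq {u : ℕ → ℝ} {l : ℝ} (hu : Monotone u)
    (h : Tendsto (fun n : ℕ => u (n ^ 2) / ((n ^ 2 : ℕ) : ℝ)) atTop (𝓝 l)) :
    Tendsto (fun n => u n / n) atTop (𝓝 l) := by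
  refine tendsto_div_of_monotone_of_exists_subseq_tendsto_div u l hu fun a ha =>
    ⟨fun n => n ^ 2, ?_, tendsto_pow_atTop two_ne_zero, h⟩
  -- For `n ≥ 1`, `(n + 1) ^ 2 ≤ n ^ 2 + 3 * n`, which is at most `a * n ^ 2` once `n * (a - 1) ≥
  -- 3`.
  obtain ⟨N, hN⟩ := exists_nat_gt (3 / (a - 1))
  rw [div_lt_iff₀ (by linarith)] at hN
  filter_upwards [eventually_ge_atTop (max N 1)] with n hn
  have h1 : (N : ℝ) ≤ n := by exact_mod_cast (le_max_left _ _).trans hn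
  have h2 : (1 : ℝ) ≤ n := by exact_mod_cast (le_max_right _ _).trans hn
  push_cast
  have h3 : 3 ≤ n * (a - 1) := hN.le.trans (mul_le_mul_of_nonneg_right h1 (by linarith))
  nlinarith

lemma IsPerturbedWalk.isLimitingOccupation (h : IsPerturbedWalk μ L p q X) (hL : 1 ≤ L)
    {π : State L → ℝ} (hpois : ∀ f : State L → ℝ, ∃ h : State L → ℝ,
      ∀ η, f η - ∑ ζ, π ζ * f ζ = h η - transition p q h η) :
    IsLimitingOccupation μ X π := by
  classical
  unfold IsLimitingOccupation
  rw [ae_all_iff]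
  intro η
  obtain ⟨φ, hφ⟩ := hpois (Pi.single η 1)
  have hπη : ∑ ζ, π ζ * (Pi.single η 1 : State L → ℝ) ζ = π η := by
    simp [Pi.single_apply]
  rw [hπη] at hφ
  filter_upwards [h.ae_nearestNeighbour, h.ae_tendsto_dynkin_div hL φ] with ω hnn hω
  set x : ℕ → ℤ := fun j => X j ω with hx
  set u : ℕ → ℝ := fun n => (((Finset.range n).filter fun k => HasState x (L + k) η).card : ℝ)
    with hu
  have hocc : occupation x η = fun n : ℕ => u n / n := by
    funext n
    unfold occupation
    congr!
  rw [hocc]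
  have hmono : Monotone u := fun m n hmn => by
    simp only [hu]
    exact_mod_cast Finset.card_le_card
      (Finset.filter_subset_filter _ (Finset.range_subset_range.mpr hmn))
  refine tendsto_div_of_monotone_of_tendsto_sq hmono ?_
  -- Summing the Poisson equation along the path telescopes up to the martingale.
  have hun : ∀ n : ℕ, u n = n * π η + (φ (window L x L) - φ (window L x (L + n))) +
      dynkin L p q X φ n ω := by
    intro n
    simp only [hu]
    rw [Finset.card_filter]
    push_cast
    induction n with
    | zero => simp [dynkin]
    | succ n ih =>
      rw [Finset.sum_range_succ, ih]
      have e1 := hφ (window L x (L + n))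
      have e2 : dynkin L p q X φ (n + 1) ω = dynkin L p q X φ n ω +
          (φ (window L x (L + n + 1)) - transition p q φ (window L x (L + n))) := by
        unfold dynkin
        rw [Finset.sum_range_succ]
      have e3 : (if HasState x (L + n) η then (1 : ℝ) else 0) =
          (Pi.single η 1 : State L → ℝ) (window L x (L + n)) := by
        rw [Pi.single_apply]
        exact if_congr ((hnn _).hasState_iff (by omega) η) rfl rfl
      rw [e2, e3, ← add_assoc L n 1]
      push_cast
      linarith
  obtain ⟨a, ha⟩ := Finite.exists_max fun η => |φ η|
  have hsq : Tendsto (fun n : ℕ => ((n ^ 2 : ℕ) : ℝ)) atTop atTop :=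
    tendsto_natCast_atTop_atTop.comp (tendsto_pow_atTop two_ne_zero)
  have hb : Tendsto (fun n : ℕ => (φ (window L x L) - φ (window L x (L + n ^ 2))) /
      ((n ^ 2 : ℕ) : ℝ)) atTop (𝓝 0) := by
    refine squeeze_zero_norm (fun n => ?_)
      ((tendsto_const_nhds (x := |φ a| + |φ a|)).div_atTop hsq)
    rw [norm_div, Real.norm_eq_abs, Real.norm_natCast]
    exact div_le_div_of_nonneg_right ((abs_sub _ _).trans (add_le_add (ha _) (ha _)))
      (Nat.cast_nonneg _)
  have hlim := ((tendsto_const_nhds (x := π η)).add hb).add hω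
  rw [add_zero, add_zero] at hlim
  refine hlim.congr' ?_
  filter_upwards [eventually_ge_atTop 1] with n hn
  have hn' : (n : ℝ) ≠ 0 := by positivity
  rw [hun]
  push_cast
  field_simp

end Trajectory

end PerturbedWalk

theorem lemma2 (L : ℕ) (hL : 1 ≤ L) (p q : ℝ) (hp0 : 0 < p) (hp1 : p < 1)
    (hq0 : 0 < q) (hq1 : q < 1) :
    ∃ π : PerturbedWalk.State L → ℝ,
      (∀ (Ω : Type*) [MeasurableSpace Ω] (μ : MeasureTheory.Measure Ω)
        [MeasureTheory.IsProbabilityMeasure μ] (X : ℕ → Ω → ℤ),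
        PerturbedWalk.IsPerturbedWalk μ L p q X → PerturbedWalk.IsLimitingOccupation μ X π) ∧
      (PerturbedWalk.speed p q π < 0 ↔ p + q - 1 < 0) ∧
      (PerturbedWalk.speed p q π = 0 ↔ p + q - 1 = 0) ∧
      (0 < PerturbedWalk.speed p q π ↔ 0 < p + q - 1) := by
  obtain ⟨π, hπ, hsum, hstat, hpois⟩ :=
    PerturbedWalk.exists_stationary (L := L) hp0 hp1 hq0 hq1
  exact ⟨π, fun Ω _ μ _ X hX => hX.isLimitingOccupation hL hpois,
    PerturbedWalk.speed_sign hL hp0 hp1 hπ hsum hstat⟩
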